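/- For a compact set $B\subseteq\mathbb R$ let $Z(B)$ be the set of all open intervals $(\alpha,\beta)\subseteq\mathbb R\setminus B$ with $\alpha,\beta\in B$, $\alpha<\beta$. For real $t>0$, $B$ is called a $0_t$-set if it has Lebesgue measure $0$ and $\sum_{z\in Z(B)}|z|^{1/t}<\infty$, where $|z|$ is the length of $z$; for real $s\ge 1$, $B$ is called a $0_{<s}$-set if it is a $0_t$-set for every real $t$ with $0<t<s$. A set $A\subseteq\mathbb R$ is a $\sigma$-$0_{<s}$ set if $A=\bigcup_{i\in\mathbb N}A_i$ with each $A_i$ a (compact) $0_{<s}$-set. For an integer $k\ge 0$ and $\lambda\in[0,1)$, a function $F:\mathbb R^n\to\mathbb R$ is of class $C^{k+\lambda}$ if it is $C^k$ and every point of $\mathbb R^n$ has a neighbourhood $U$ with a constant $M$ such that $\|D^kF(x)-D^kF(y)\|\le M|x-y|^\lambda$ for all $x,y\in U$. It is of class $C^{<q}$ if it is of class $C^t$ for every real $t$ with $0\le t<q$. Let $C_vF=\{F(x): x\in\mathbb R^n,\ DF(x)=0\}$ be the set of critical values of $F$. **Theorem.** Let $s>1$ be a real number and let $A\subseteq\mathbb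 R$ be a $\sigma$-$0_{<s}$ set. Then for every integer $n\ge 1$ there is a function $F:\mathbb R^n\to\mathbb R$ of class $C^{<sn}$ with $A\subseteq C_vF$. -/

import Mathlib

open MeasureTheory Topology

namespace MorseSard

/-- The bounded complementary intervals `(α, β)` of a set `A ⊆ ℝ` with `α, β ∈ A`, `α < β`,
encoded by their pairs of endpoints. -/
def gaps (A : Set ℝ) : Set (ℝ × ℝ) :=
  {z | z.1 ∈ A ∧ z.2 ∈ A ∧ z.1 < z.2 ∧ Set.Ioo z.1 z.2 ⊆ Aᶜ}

/-- A compact set `A ⊆ ℝ` is a set of `k`-degree, `k > 0`, if the series of the lengths of its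
gaps, raised to the power `1 / k`, converges. -/
structure IsDegreeSet (k : ℝ) (A : Set ℝ) : Prop where
  pos : 0 < k
  isCompact : IsCompact A
  summable : Summable fun z : gaps A => (z.1.2 - z.1.1) ^ (1 / k)

/-- A `0_k`-set: a set of `k`-degree of Lebesgue measure zero. -/
structure IsZeroSet (k : ℝ) (A : Set ℝ) : Prop where
  isDegreeSet : IsDegreeSet k A
  volume_eq_zero : volume A = 0

/-- A `0_{<k}`-set: a compact set that is a `0_t`-set for every positive real `t < k`. -/
structure IsZeroLtSet (k : ℝ) (A : Set ℝ) : Prop where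
  isCompact : IsCompact A
  isZeroSet : ∀ t : ℝ, 0 < t → t < k → IsZeroSet t A

/-- A `σ-0_{<k}` set: a countable union of `0_{<k}`-sets. -/
def IsSigmaZeroLtSet (k : ℝ) (A : Set ℝ) : Prop :=
  ∃ B : ℕ → Set ℝ, (∀ i, IsZeroLtSet k (B i)) ∧ A = ⋃ i, B i

section Smoothness

variable {E F : Type*} [NormedAddCommGroup E] [NormedSpace ℝ E]
  [NormedAddCommGroup F] [NormedSpace ℝ F]

/-- The class `C^{k+r}` for `k ∈ ℕ`, `r ∈ [0, 1)`: `f` is `C^k`, and its `k`-th derivative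
satisfies locally a Hölder condition with exponent `r`. -/
structure IsCHolder (k : ℕ) (r : ℝ) (f : E → F) : Prop where
  contDiff : ContDiff ℝ k f
  holder : ∀ x₀ : E, ∃ U ∈ 𝓝 x₀, ∃ M : ℝ, ∀ x ∈ U, ∀ y ∈ U,
    ‖iteratedFDeriv ℝ k f x - iteratedFDeriv ℝ k f y‖ ≤ M * ‖x - y‖ ^ r

/-- The class `C^{<q}`: `f` is of class `C^t` for every `t = k + r < q`,
where `k ∈ ℕ` and `r ∈ [0, 1)`. -/
def IsCLt (q : ℝ) (f : E → F) : Prop :=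
  ∀ (k : ℕ) (r : ℝ), 0 ≤ r → r < 1 → (k : ℝ) + r < q → IsCHolder k r f

/-- The set `C_p f` of critical points of rank zero: `f` has a derivative at `x`, of rank `0`. -/
def criticalPoints (f : E → F) : Set E :=
  {x | DifferentiableAt ℝ f x ∧ LinearMap.rank (fderiv ℝ f x : E →ₗ[ℝ] F) = 0}

/-- The set `C_v f = f (C_p f)` of critical values. -/
def criticalValues (f : E → F) : Set F :=
  f '' criticalPoints f

end Smoothness

end MorseSard

/-! For a single `0_{<s}`-set `B`, position is measured through the gaps. One summable weight `w`
satisfies |z| ≤ C_t w(z)^t for every t in [1, s) (`IsZeroLtSet.exists_weights`); let g(b) be the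
normalised total weight of the gaps to the left of b. As B is null, |b - b'| is at most the total
length of the gaps in between, and superadditivity of v ↦ v^t turns this into |b - b'| ≤ C |g b - g
b'|^t (`IsZeroLtSet.exists_parametrization`).

The parameter is then spread over ℝⁿ. Level k cuts [0, 1) into (k!)ⁿ intervals and matches them with
(k!)ⁿ nested centres, separated by `scale n k`, which is 1/k! up to a geometric factor. F sums over
all levels the bumps whose heights are increments of chosen points of B
(`exists_function_of_parametrization`). The centres along the branch of b converge to a point x on
the plateau of each bump of that branch, so F x telescopes to b and DF x = 0.

Increments at level k+1 are O((k!)^(-nt)), and p derivatives cost `scale n (k + 1)` to the power -p.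
Because the branching number grows with k, the factorials absorb the geometric loss spent on
separating cells, and the series converges for all p < nt (`summable_factorial_rpow_mul_scale`).
Letting t approach s covers every p < sn. Countably many such functions are placed on disjoint balls
(`isCLt_tsum`). -/

namespace MorseSard

/-! ### Hölder regularity of series of scaled bumps. -/

section SmoothSeries

open scoped ContDiff

variable {E F : Type*} [NormedAddCommGroup E] [NormedSpace ℝ E]
  [NormedAddCommGroup F] [NormedSpace ℝ F]

/-- A series of smooth functions whose `j`-th derivatives grow like `a k * (η k)⁻¹ ^ j` is of
class `C^{j+r}` as soon as `∑ a k * (η k)⁻¹ ^ (j + r)` converges. -/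
theorem isCHolder_tsum [CompleteSpace F] {f : ℕ → E → F} (hf : ∀ k, ContDiff ℝ ∞ (f k))
    {η a D : ℕ → ℝ} (hη0 : ∀ k, 0 < η k) (hη1 : ∀ k, η k ≤ 1) (ha : ∀ k, 0 ≤ a k)
    (hD : ∀ j, 0 ≤ D j)
    (hb : ∀ j k x, ‖iteratedFDeriv ℝ j (f k) x‖ ≤ D j * a k * (η k)⁻¹ ^ j)
    (j : ℕ) (r : ℝ) (hr0 : 0 ≤ r) (hr1 : r ≤ 1)
    (hs : Summable fun k => a k * (η k)⁻¹ ^ ((j : ℝ) + r)) :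
    IsCHolder j r (fun x => ∑' k, f k x) := by
  have hη : ∀ k, 1 ≤ (η k)⁻¹ := fun k => (one_le_inv₀ (hη0 k)).2 (hη1 k)
  have hle : ∀ i : ℕ, (i : ℕ∞) ≤ (j : ℕ∞) →
      Summable fun k => D i * a k * (η k)⁻¹ ^ i := by
    intro i hi
    have hij : i ≤ j := by exact_mod_cast hi
    refine Summable.of_nonneg_of_le (fun k => ?_) (fun k => ?_) (hs.mul_left (D i))
    · have := hD i; have := ha k; have := (hη0 k).le; positivity
    · rw [mul_assoc]
      refine mul_le_mul_of_nonneg_left (mul_le_mul_of_nonneg_left ?_ (ha k)) (hD i)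
      rw [← Real.rpow_natCast]
      refine Real.rpow_le_rpow_of_exponent_le (hη k) ?_
      have : (i : ℝ) ≤ j := by exact_mod_cast hij
      linarith
  have hsm : ∀ k, ContDiff ℝ ((j : ℕ∞) : WithTop ℕ∞) (f k) := fun k =>
    (hf k).of_le (by exact_mod_cast le_top)
  have hbd : ∀ (i k : ℕ) (x : E), (i : ℕ∞) ≤ (j : ℕ∞) →
      ‖iteratedFDeriv ℝ i (f k) x‖ ≤ D i * a k * (η k)⁻¹ ^ i := fun i k x _ => hb i k x
  have hsum : ∀ x, Summable fun k => iteratedFDeriv ℝ j (f k) x := fun x =>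
    Summable.of_norm_bounded (hle j le_rfl) fun k => hb j k x
  have hdiff : ∀ k x y, ‖iteratedFDeriv ℝ j (f k) x - iteratedFDeriv ℝ j (f k) y‖ ≤
      (2 * D j + D (j + 1)) * (a k * (η k)⁻¹ ^ ((j : ℝ) + r)) * ‖x - y‖ ^ r := by
    intro k x y
    -- This constant serves both the trivial bound `h1` and the Lipschitz bound `h2`.
    set X : ℝ := (2 * D j + D (j + 1)) * (a k * (η k)⁻¹ ^ j) with hX
    have hX0 : 0 ≤ X := by
      have := hD j; have := hD (j + 1); have := ha k; have := (hη0 k).le; positivity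
    have hP : 0 ≤ a k * (η k)⁻¹ ^ j := by
      have := ha k; have := (hη0 k).le; positivity
    have h1 : ‖iteratedFDeriv ℝ j (f k) x - iteratedFDeriv ℝ j (f k) y‖ ≤ X := by
      refine (norm_sub_le _ _).trans ?_
      have e1 := hb j k x
      have e2 := hb j k y
      have e3 := mul_nonneg (hD (j + 1)) hP
      rw [hX]; nlinarith
    have h2 : ‖iteratedFDeriv ℝ j (f k) x - iteratedFDeriv ℝ j (f k) y‖ ≤
        X * ((η k)⁻¹ * ‖x - y‖) := by
      have := Convex.norm_image_sub_le_of_norm_fderiv_le (𝕜 := ℝ)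
        (f := iteratedFDeriv ℝ j (f k)) (C := D (j + 1) * a k * (η k)⁻¹ ^ (j + 1))
        (s := Set.univ) (x := y) (y := x)
        (fun z _ => ((hf k).differentiable_iteratedFDeriv
          (by exact_mod_cast ENat.natCast_lt_top j)) z)
        (fun z _ => by rw [norm_fderiv_iteratedFDeriv]; exact hb (j + 1) k z)
        convex_univ (Set.mem_univ _) (Set.mem_univ _)
      refine this.trans ?_
      rw [hX, pow_succ]
      have e4 : 0 ≤ 2 * D j * (a k * (η k)⁻¹ ^ j) * ((η k)⁻¹ * ‖x - y‖) := by
        have := hD j; have := (hη0 k).le; positivity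
      nlinarith
    have hη' : 0 ≤ (η k)⁻¹ := (inv_pos.2 (hη0 k)).le
    have hu : 0 ≤ (η k)⁻¹ * ‖x - y‖ := by positivity
    -- Interpolation: min(1, u) ≤ u^r for u ≥ 0 and 0 ≤ r ≤ 1.
    have h3 : ‖iteratedFDeriv ℝ j (f k) x - iteratedFDeriv ℝ j (f k) y‖ ≤
        X * ((η k)⁻¹ * ‖x - y‖) ^ r := by
      rcases le_total ((η k)⁻¹ * ‖x - y‖) 1 with h | h
      · refine h2.trans (mul_le_mul_of_nonneg_left ?_ hX0)
        rcases hu.eq_or_lt with h0 | h0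
        · rw [← h0]; exact Real.rpow_nonneg le_rfl _
        · simpa using Real.rpow_le_rpow_of_exponent_ge h0 h hr1
      · exact h1.trans (le_mul_of_one_le_right hX0 (Real.one_le_rpow h hr0))
    refine h3.trans_eq ?_
    rw [hX, Real.mul_rpow hη' (norm_nonneg _), Real.rpow_add (inv_pos.2 (hη0 k)),
      Real.rpow_natCast]
    ring
  refine ⟨contDiff_tsum hsm hle hbd, fun x₀ => ⟨Set.univ, Filter.univ_mem,
    ∑' k, (2 * D j + D (j + 1)) * (a k * (η k)⁻¹ ^ ((j : ℝ) + r)), fun x _ y _ => ?_⟩⟩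
  have hs' := hs.mul_left (2 * D j + D (j + 1))
  rw [iteratedFDeriv_tsum_apply hsm hle hbd le_rfl, iteratedFDeriv_tsum_apply hsm hle hbd le_rfl,
    ← (hsum x).tsum_sub (hsum y), ← tsum_mul_right]
  exact tsum_of_norm_bounded (hs'.mul_right _).hasSum fun k => hdiff k x y

/-- A finite sum of bumps of the shape `ρ`, scaled by `η` and centred at the points `c q`. -/
noncomputable def bumpLayer {ι : Type*} (ρ : E → ℝ) (η : ℝ) (S : Finset ι) (c : ι → E) (α : ι → ℝ)
    (y : E) : ℝ :=
  ∑ q ∈ S, α q * ρ (η⁻¹ • (y - c q))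

section Layer

variable {ι : Type*} {ρ : E → ℝ} {η : ℝ} {S : Finset ι} {c : ι → E} {α : ι → ℝ}

theorem contDiff_bump_term (hρ : ContDiff ℝ ∞ ρ) (q : ι) :
    ContDiff ℝ ∞ fun y => α q * ρ (η⁻¹ • (y - c q)) := by
  fun_prop

theorem contDiff_bumpLayer (hρ : ContDiff ℝ ∞ ρ) : ContDiff ℝ ∞ (bumpLayer ρ η S c α) :=
  ContDiff.sum fun q _ => contDiff_bump_term hρ q

theorem iteratedFDeriv_bump_term (hρ : ContDiff ℝ ∞ ρ) (j : ℕ) (q : ι) (y : E) :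
    iteratedFDeriv ℝ j (fun y => α q * ρ (η⁻¹ • (y - c q))) y =
      α q • η⁻¹ ^ j • iteratedFDeriv ℝ j ρ (η⁻¹ • (y - c q)) := by
  have hρj : ContDiff ℝ j ρ := hρ.of_le (by exact_mod_cast le_top)
  have h1 : ContDiff ℝ j fun y => ρ (η⁻¹ • (y - c q)) := by fun_prop
  have h2 := iteratedFDeriv_const_smul_apply (a := α q) (x := y) h1.contDiffAt
  have h3 := congrFun (iteratedFDeriv_comp_sub' (𝕜 := ℝ) (f := fun z => ρ (η⁻¹ • z)) j (c q)) y
  have h4 := congrFun (iteratedFDeriv_comp_const_smul (η⁻¹) hρj) (y - c q)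
  rw [← h4, ← h3, ← h2]
  rfl

/-- If the centres are `η`-separated and `ρ` lives in the ball of radius `1 / 4`, then at most one
bump of a layer contributes at each point. -/
theorem norm_iteratedFDeriv_bumpLayer_le (hρ : ContDiff ℝ ∞ ρ)
    (hρ0 : ∀ y, 1 / 4 ≤ ‖y‖ → ρ y = 0) (hη : 0 < η)
    (hc : ∀ q ∈ S, ∀ q' ∈ S, q ≠ q' → η ≤ ‖c q - c q'‖) {a : ℝ} (ha : 0 ≤ a)
    (hα : ∀ q ∈ S, |α q| ≤ a) {j : ℕ} {D : ℝ} (hD : ∀ y, ‖iteratedFDeriv ℝ j ρ y‖ ≤ D) (y : E) :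
    ‖iteratedFDeriv ℝ j (bumpLayer ρ η S c α) y‖ ≤ D * a * η⁻¹ ^ j := by
  have hD0 : 0 ≤ D := (norm_nonneg _).trans (hD 0)
  have hη' : 0 < η⁻¹ := inv_pos.2 hη
  have hsum : iteratedFDeriv ℝ j (bumpLayer ρ η S c α) y =
      ∑ q ∈ S, α q • η⁻¹ ^ j • iteratedFDeriv ℝ j ρ (η⁻¹ • (y - c q)) := by
    have := iteratedFDeriv_fun_sum_apply (𝕜 := ℝ) (u := S) (n := j) (x := y)
      (f := fun q y => α q * ρ (η⁻¹ • (y - c q)))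
      (fun q _ => ((contDiff_bump_term hρ q).of_le (by exact_mod_cast le_top)).contDiffAt)
    rw [← Finset.sum_congr rfl fun q _ => iteratedFDeriv_bump_term hρ j q y, ← this]
    rfl
  have hsupp : ∀ z : E, 1 / 4 < ‖z‖ → iteratedFDeriv ℝ j ρ z = 0 := by
    intro z hz
    by_contra hne
    have h1 : z ∈ tsupport ρ := support_iteratedFDeriv_subset j hne
    have h2 : tsupport ρ ⊆ Metric.closedBall 0 (1 / 4) :=
      closure_minimal (fun w hw => by
        by_contra hw'
        rw [mem_closedBall_zero_iff, not_le] at hw'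
        exact hw (hρ0 w hw'.le)) Metric.isClosed_closedBall
    have := mem_closedBall_zero_iff.1 (h2 h1)
    linarith
  have hnear : ∀ q, iteratedFDeriv ℝ j ρ (η⁻¹ • (y - c q)) ≠ 0 → ‖y - c q‖ ≤ η / 4 := by
    intro q hq
    by_contra! h
    refine hq (hsupp _ ?_)
    rw [norm_smul, Real.norm_of_nonneg hη'.le]
    calc (1 / 4 : ℝ) = η⁻¹ * (η / 4) := by field_simp
      _ < _ := by gcongr
  rw [hsum]
  by_cases hex : ∃ q ∈ S, iteratedFDeriv ℝ j ρ (η⁻¹ • (y - c q)) ≠ 0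
  · obtain ⟨q, hq, hq'⟩ := hex
    rw [Finset.sum_eq_single_of_mem q hq]
    · rw [norm_smul, norm_smul, norm_pow, Real.norm_of_nonneg hη'.le, Real.norm_eq_abs]
      calc _ ≤ a * (η⁻¹ ^ j * D) := by gcongr; exacts [hα q hq, hD _]
        _ = _ := by ring
    · intro q₁ hq₁ hne
      by_contra h
      have h1 := hnear q hq'
      have h2 := hnear q₁ (fun h0 => h (by rw [h0]; simp))
      have h3 := hc q₁ hq₁ q hq hne
      have h4 : ‖c q₁ - c q‖ ≤ ‖y - c q‖ + ‖y - c q₁‖ := by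
        rw [show c q₁ - c q = (y - c q) - (y - c q₁) by abel]
        exact norm_sub_le _ _
      linarith
  · push Not at hex
    rw [Finset.sum_eq_zero fun q hq => by rw [hex q hq]; simp]
    rw [norm_zero]; positivity

theorem bumpLayer_eq_of_near (hρ0 : ∀ y, 1 / 4 ≤ ‖y‖ → ρ y = 0) (hρ1 : ∀ y, ‖y‖ ≤ 1 / 8 → ρ y = 1)
    (hη : 0 < η) (hc : ∀ q ∈ S, ∀ q' ∈ S, q ≠ q' → η ≤ ‖c q - c q'‖) {q : ι} (hq : q ∈ S) {y : E}
    (hy : ‖y - c q‖ ≤ η / 8) :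
    bumpLayer ρ η S c α y = α q := by
  have hη' : 0 < η⁻¹ := inv_pos.2 hη
  have hn : ∀ z : E, ‖η⁻¹ • z‖ = η⁻¹ * ‖z‖ := fun z => by
    rw [norm_smul, Real.norm_of_nonneg hη'.le]
  rw [bumpLayer, Finset.sum_eq_single_of_mem q hq, hρ1, mul_one]
  · rw [hn]
    calc η⁻¹ * ‖y - c q‖ ≤ η⁻¹ * (η / 8) := by gcongr
      _ = 1 / 8 := by field_simp
  · intro q₁ hq₁ hne
    rw [hρ0, mul_zero]
    have h3 := hc q₁ hq₁ q hq hne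
    have h4 : ‖c q₁ - c q‖ ≤ ‖y - c q‖ + ‖y - c q₁‖ := by
      rw [show c q₁ - c q = (y - c q) - (y - c q₁) by abel]
      exact norm_sub_le _ _
    rw [hn]
    calc (1 / 4 : ℝ) = η⁻¹ * (η / 4) := by field_simp
      _ ≤ _ := by gcongr; linarith

theorem bumpLayer_eq_zero (hρ0 : ∀ y, 1 / 4 ≤ ‖y‖ → ρ y = 0) (hη : 0 < η) {y : E}
    (hy : ∀ q ∈ S, η / 4 ≤ ‖y - c q‖) :
    bumpLayer ρ η S c α y = 0 := by
  refine Finset.sum_eq_zero fun q hq => ?_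
  have hη' : 0 < η⁻¹ := inv_pos.2 hη
  rw [hρ0, mul_zero]
  rw [norm_smul, Real.norm_of_nonneg hη'.le]
  calc (1 / 4 : ℝ) = η⁻¹ * (η / 4) := by field_simp
    _ ≤ _ := by gcongr; exact hy q hq

/-- Every bump of the layer takes an extreme value of `ρ` at a point close to a centre. -/
theorem fderiv_bumpLayer_eq_zero (hρ : ContDiff ℝ ∞ ρ) (hρI : ∀ y, ρ y ∈ Set.Icc (0 : ℝ) 1)
    (hρ0 : ∀ y, 1 / 4 ≤ ‖y‖ → ρ y = 0) (hρ1 : ∀ y, ‖y‖ ≤ 1 / 8 → ρ y = 1)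
    (hη : 0 < η) (hc : ∀ q ∈ S, ∀ q' ∈ S, q ≠ q' → η ≤ ‖c q - c q'‖) {q : ι} (hq : q ∈ S) {y : E}
    (hy : ‖y - c q‖ ≤ η / 8) :
    fderiv ℝ (bumpLayer ρ η S c α) y = 0 := by
  have hη' : 0 < η⁻¹ := inv_pos.2 hη
  have hn : ∀ z : E, ‖η⁻¹ • z‖ = η⁻¹ * ‖z‖ := fun z => by
    rw [norm_smul, Real.norm_of_nonneg hη'.le]
  have hd : Differentiable ℝ ρ := hρ.differentiable (by simp)
  have hterm : ∀ q₁ ∈ S, fderiv ℝ (fun z => ρ (η⁻¹ • (z - c q₁))) y = 0 := by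
    intro q₁ hq₁
    by_cases hne : q₁ = q
    · subst hne
      refine IsLocalMax.fderiv_eq_zero (Filter.Eventually.of_forall fun z => ?_)
      have : ρ (η⁻¹ • (y - c q₁)) = 1 := by
        apply hρ1
        rw [hn]
        calc η⁻¹ * ‖y - c q₁‖ ≤ η⁻¹ * (η / 8) := by gcongr
          _ = 1 / 8 := by field_simp
      simp only [this]; exact (hρI _).2
    · refine IsLocalMin.fderiv_eq_zero (Filter.Eventually.of_forall fun z => ?_)
      have h3 := hc q₁ hq₁ q hq hne
      have h4 : ‖c q₁ - c q‖ ≤ ‖y - c q‖ + ‖y - c q₁‖ := by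
        rw [show c q₁ - c q = (y - c q) - (y - c q₁) by abel]
        exact norm_sub_le _ _
      have : ρ (η⁻¹ • (y - c q₁)) = 0 := by
        apply hρ0
        rw [hn]
        calc (1 / 4 : ℝ) = η⁻¹ * (η / 4) := by field_simp
          _ ≤ _ := by gcongr; linarith
      simp only [this]; exact (hρI _).1
  have hdt : ∀ q₁, DifferentiableAt ℝ (fun z => ρ (η⁻¹ • (z - c q₁))) y := fun q₁ => by fun_prop
  have : bumpLayer ρ η S c α = fun z => ∑ q₁ ∈ S, α q₁ * ρ (η⁻¹ • (z - c q₁)) := rfl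
  rw [this, fderiv_fun_sum fun q₁ _ => (hdt q₁).const_mul _]
  refine Finset.sum_eq_zero fun q₁ hq₁ => ?_
  rw [fderiv_const_mul (hdt q₁), hterm q₁ hq₁, smul_zero]

end Layer

end SmoothSeries

/-! ### Hölder parametrization of a null set by its gaps. -/

section Gaps

/-- Weights of the gaps of a `0_{<s}`-set that work for all exponents `t < s` at once. -/
theorem IsZeroLtSet.exists_weights {s : ℝ} (hs : 1 < s) {B : Set ℝ} (hB : IsZeroLtSet s B) :
    ∃ w : gaps B → ℝ, (∀ z, 0 ≤ w z) ∧ Summable w ∧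
      ∀ t, 1 ≤ t → t < s → ∃ C, 0 ≤ C ∧ ∀ z, z.1.2 - z.1.1 ≤ C * w z ^ t := by
  have hlen : ∀ z : gaps B, 0 < z.1.2 - z.1.1 := fun z => sub_pos.2 z.2.2.2.1
  -- Countably many exponents in [1, s) tending to s suffice.
  obtain ⟨T, hT⟩ : ∃ T : ℕ → ℝ, ∀ m, T m = s - (s - 1) / (m + 1) := ⟨_, fun _ => rfl⟩
  have hT1 : ∀ m, 1 ≤ T m := fun m => by
    rw [hT]
    have : (s - 1) / ((m : ℝ) + 1) ≤ s - 1 :=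
      div_le_self (by linarith) (by have : (0 : ℝ) ≤ m := m.cast_nonneg; linarith)
    linarith
  have hTs : ∀ m, T m < s := fun m => by
    rw [hT]
    have : 0 < (s - 1) / ((m : ℝ) + 1) := div_pos (by linarith) (by positivity)
    linarith
  have hS : ∀ m, Summable fun z : gaps B => (z.1.2 - z.1.1) ^ (1 / T m) := fun m =>
    (hB.isZeroSet (T m) (by linarith [hT1 m]) (hTs m)).isDegreeSet.summable
  set S : ℕ → ℝ := fun m => ∑' z : gaps B, (z.1.2 - z.1.1) ^ (1 / T m) with hSdef
  have hS0 : ∀ m, 0 ≤ S m := fun m => tsum_nonneg fun z => Real.rpow_nonneg (hlen z).le _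
  -- The m-th series then contributes at most 2^(-m), so the weights summed over all m stay summable
  -- while dominating each series.
  obtain ⟨c, hc⟩ : ∃ c : ℕ → ℝ, ∀ m, c m = (1 / 2) ^ m / (S m + 1) := ⟨_, fun _ => rfl⟩
  have hc0 : ∀ m, 0 < c m := fun m => by rw [hc]; have := hS0 m; positivity
  set f : ℕ × gaps B → ℝ := fun p => c p.1 * (p.2.1.2 - p.2.1.1) ^ (1 / T p.1) with hf
  have hf0 : 0 ≤ f := fun p => mul_nonneg (hc0 _).le (Real.rpow_nonneg (hlen _).le _)
  have hfs : Summable f := by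
    rw [summable_prod_of_nonneg hf0]
    refine ⟨fun m => (hS m).mul_left (c m), ?_⟩
    refine Summable.of_nonneg_of_le (fun m => tsum_nonneg fun z => hf0 _) (fun m => ?_)
      summable_geometric_two
    simp only [hf]
    rw [tsum_mul_left, hc, div_mul_eq_mul_div, div_le_iff₀ (by linarith [hS0 m])]
    exact mul_le_mul_of_nonneg_left (by linarith) (by positivity)
  have hfs' : Summable fun p : gaps B × ℕ => f p.swap := hfs.prod_symm
  have hw := hfs'.prod
  set w : gaps B → ℝ := fun z => ∑' m, f (m, z) with hwdef
  have hw' : Summable w := hw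
  have hw0 : ∀ z, 0 ≤ w z := fun z => tsum_nonneg fun m => hf0 _
  refine ⟨w, hw0, hw', fun t ht1 hts => ?_⟩
  obtain ⟨m, hm⟩ := exists_nat_gt ((s - 1) / (s - t))
  have htm : t ≤ T m := by
    rw [hT]
    rw [div_lt_iff₀ (by linarith)] at hm
    have : (s - 1) / ((m : ℝ) + 1) ≤ s - t := by
      rw [div_le_iff₀ (by positivity)]
      nlinarith
    linarith
  have hTm : 0 < T m := by linarith
  -- The surplus power `T m - t` of `w z` is bounded by that of the total weight.
  refine ⟨(1 / c m) ^ T m * (∑' z, w z) ^ (T m - t), ?_, fun z => ?_⟩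
  · have : 0 ≤ ∑' z, w z := tsum_nonneg hw0
    have := hc0 m
    positivity
  have h1 : c m * (z.1.2 - z.1.1) ^ (1 / T m) ≤ w z :=
    (hfs'.prod_factor z).le_tsum m (fun _ _ => hf0 _)
  have h2 : (z.1.2 - z.1.1) ^ (1 / T m) ≤ 1 / c m * w z := by
    rw [one_div_mul_eq_div, le_div_iff₀ (hc0 m)]
    linarith
  have h3 : z.1.2 - z.1.1 ≤ (1 / c m * w z) ^ T m := by
    have := Real.rpow_le_rpow (Real.rpow_nonneg (hlen z).le _) h2 hTm.le
    rwa [← Real.rpow_mul (hlen z).le, one_div_mul_cancel hTm.ne', Real.rpow_one] at this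
  refine h3.trans ?_
  have hcm : 0 ≤ 1 / c m := by have := hc0 m; positivity
  rw [Real.mul_rpow hcm (hw0 z), mul_assoc]
  refine mul_le_mul_of_nonneg_left ?_ (Real.rpow_nonneg hcm _)
  have h4 : w z ^ T m = w z ^ (T m - t) * w z ^ t := by
    rw [← Real.rpow_add_of_nonneg (hw0 z) (by linarith) (by linarith), sub_add_cancel]
  rw [h4]
  refine mul_le_mul_of_nonneg_right ?_ (Real.rpow_nonneg (hw0 z) _)
  exact Real.rpow_le_rpow (hw0 z) (hw'.le_tsum z fun _ _ => hw0 _) (by linarith)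

theorem countable_gaps {k : ℝ} {B : Set ℝ} (hB : IsDegreeSet k B) : Countable (gaps B) := by
  have h := hB.summable.countable_support
  rw [← Set.countable_univ_iff]
  refine h.mono fun z _ => ?_
  exact (Real.rpow_pos_of_pos (sub_pos.2 z.2.2.2.1) _).ne'

/-- A point between two points of a compact set lies in the set or in a gap between them. -/
theorem exists_gap {B : Set ℝ} (hB : IsCompact B) {b b' x : ℝ} (hb : b ∈ B) (hb' : b' ∈ B)
    (hx : x ∈ Set.Icc b b') (hxB : x ∉ B) :
    ∃ z : gaps B, b ≤ z.1.1 ∧ z.1.2 ≤ b' ∧ x ∈ Set.Ioo z.1.1 z.1.2 := by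
  have hL : IsCompact (B ∩ Set.Iic x) := hB.inter_right isClosed_Iic
  have hR : IsCompact (B ∩ Set.Ici x) := hB.inter_right isClosed_Ici
  have hl := hL.sSup_mem ⟨b, hb, hx.1⟩
  have hr := hR.sInf_mem ⟨b', hb', hx.2⟩
  have hlx : sSup (B ∩ Set.Iic x) < x := lt_of_le_of_ne hl.2 fun h => hxB (h ▸ hl.1)
  have hxr : x < sInf (B ∩ Set.Ici x) := lt_of_le_of_ne hr.2 fun h => hxB (h ▸ hr.1)
  refine ⟨⟨(sSup (B ∩ Set.Iic x), sInf (B ∩ Set.Ici x)), hl.1, hr.1, hlx.trans hxr, ?_⟩,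
    le_csSup hL.bddAbove ⟨hb, hx.1⟩, csInf_le hR.bddBelow ⟨hb', hx.2⟩, hlx, hxr⟩
  intro y hy hyB
  rcases le_total y x with h | h
  · exact absurd (le_csSup hL.bddAbove ⟨hyB, h⟩) (not_le.2 hy.1)
  · exact absurd (csInf_le hR.bddBelow ⟨hyB, h⟩) (not_le.2 hy.2)

/-- The distance of two points of a compact null set is at most the total length of the gaps
between them. -/
theorem ofReal_sub_le_tsum_gaps {B : Set ℝ} (hB : IsCompact B) (hB0 : volume B = 0)
    [Countable (gaps B)] {b b' : ℝ} (hb : b ∈ B) (hb' : b' ∈ B) :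
    ENNReal.ofReal (b' - b) ≤
      ∑' z : gaps B, if b ≤ z.1.1 ∧ z.1.2 ≤ b' then ENNReal.ofReal (z.1.2 - z.1.1) else 0 := by
  let I : gaps B → Set ℝ := fun z =>
    if b ≤ z.1.1 ∧ z.1.2 ≤ b' then Set.Ioo z.1.1 z.1.2 else ∅
  have hsub : Set.Icc b b' ⊆ B ∪ ⋃ z, I z := by
    intro x hx
    by_cases hxB : x ∈ B
    · exact Or.inl hxB
    · obtain ⟨z, h1, h2, h3⟩ := exists_gap hB hb hb' hx hxB
      refine Or.inr (Set.mem_iUnion.2 ⟨z, ?_⟩)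
      simp only [I, if_pos (And.intro h1 h2)]
      exact h3
  calc ENNReal.ofReal (b' - b) = volume (Set.Icc b b') := Real.volume_Icc.symm
    _ ≤ volume (B ∪ ⋃ z, I z) := measure_mono hsub
    _ ≤ volume B + volume (⋃ z, I z) := measure_union_le _ _
    _ ≤ 0 + ∑' z, volume (I z) := by rw [hB0]; gcongr; exact measure_iUnion_le _
    _ = _ := by
      rw [zero_add]
      refine tsum_congr fun z => ?_
      simp only [I]
      split_ifs
      · exact Real.volume_Ioo
      · exact measure_empty

/-- A `0_{<s}`-set has a parametrization by a subset of `[0, 1)` that is Hölder continuous with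
every exponent `t < s`. Here `g` is the inverse of the parametrization. -/
theorem IsZeroLtSet.exists_parametrization {s : ℝ} (hs : 1 < s) {B : Set ℝ}
    (hB : IsZeroLtSet s B) :
    ∃ g : ℝ → ℝ, (∀ b, 0 ≤ g b) ∧ (∀ b, g b < 1) ∧ ∀ t, 1 ≤ t → t < s →
      ∃ C, 0 ≤ C ∧ ∀ b ∈ B, ∀ b' ∈ B, |b - b'| ≤ C * |g b - g b'| ^ t := by
  obtain ⟨w, hw0, hw, hwt⟩ := hB.exists_weights hs
  have hz1 := hB.isZeroSet 1 one_pos hs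
  have := countable_gaps hz1.isDegreeSet
  set W := ∑' z, w z with hW
  have hW0 : 0 ≤ W := tsum_nonneg hw0
  have hind : ∀ (p : gaps B → Prop) [DecidablePred p], Summable fun z => if p z then w z else 0 := fun p _ =>
    Summable.of_nonneg_of_le (fun z => by split_ifs; exacts [hw0 z, le_rfl])
      (fun z => by split_ifs; exacts [le_rfl, hw0 z]) hw
  set G : ℝ → ℝ := fun b => ∑' z : gaps B, if z.1.2 ≤ b then w z else 0 with hG
  have hG0 : ∀ b, 0 ≤ G b := fun b => tsum_nonneg fun z => by split_ifs; exacts [hw0 z, le_rfl]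
  have hGW : ∀ b, G b ≤ W := fun b => (hind _).tsum_le_tsum
    (fun z => by split_ifs; exacts [le_rfl, hw0 z]) hw
  have key : ∀ t : ℝ, 1 ≤ t → ∀ C, 0 ≤ C → (∀ z : gaps B, z.1.2 - z.1.1 ≤ C * w z ^ t) →
      ∀ b ∈ B, ∀ b' ∈ B, b ≤ b' → b' - b ≤ C * |G b - G b'| ^ t := by
    intro t ht C hC hCw b hb b' hb' hbb'
    set u : gaps B → ℝ := fun z => if b ≤ z.1.1 ∧ z.1.2 ≤ b' then w z else 0 with hu
    have hu0 : ∀ z, 0 ≤ u z := fun z => by simp only [hu]; split_ifs; exacts [hw0 z, le_rfl]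
    have hus : Summable u := hind _
    have hGu : |G b - G b'| = ∑' z, u z := by
      have : G b' - G b = ∑' z, u z := by
        refine ((hind fun z => z.1.2 ≤ b').tsum_sub (hind fun z => z.1.2 ≤ b)).symm.trans
          (tsum_congr fun z => ?_)
        have h1 : b ≤ z.1.1 → ¬ z.1.2 ≤ b := fun h => not_le.2 (h.trans_lt z.2.2.2.1)
        have h2 : ¬ z.1.2 ≤ b → b ≤ z.1.1 := fun h => by
          by_contra h'
          exact z.2.2.2.2 ⟨not_le.1 h', not_le.1 h⟩ hb
        have h3 : z.1.2 ≤ b → z.1.2 ≤ b' := fun h => h.trans hbb'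
        simp only [hu]
        split_ifs <;> first | tauto | simp
      rw [abs_sub_comm, this, abs_of_nonneg (tsum_nonneg hu0)]
    rw [hGu]
    set U := ∑' z, u z with hU
    have hU0 : 0 ≤ U := tsum_nonneg hu0
    -- Superadditivity: ∑ u^t ≤ U^(t-1) ∑ u = U^t, which needs t ≥ 1.
    have hsplit : ∀ v : ℝ, 0 ≤ v → v ^ t = v * v ^ (t - 1) := fun v hv => by
      conv_lhs => rw [show t = 1 + (t - 1) by ring,
        Real.rpow_add_of_nonneg hv zero_le_one (by linarith), Real.rpow_one]
    have hle := ofReal_sub_le_tsum_gaps hz1.isDegreeSet.isCompact hz1.volume_eq_zero hb hb'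
    have hterm : ∀ z : gaps B,
        (if b ≤ z.1.1 ∧ z.1.2 ≤ b' then ENNReal.ofReal (z.1.2 - z.1.1) else 0) ≤
          ENNReal.ofReal (C * (u z * U ^ (t - 1))) := by
      intro z
      split_ifs with h
      · refine ENNReal.ofReal_le_ofReal ((hCw z).trans (mul_le_mul_of_nonneg_left ?_ hC))
        have huz : u z = w z := by simp only [hu, if_pos h]
        rw [← huz, hsplit _ (hu0 z)]
        exact mul_le_mul_of_nonneg_left (Real.rpow_le_rpow (hu0 z)
          (hus.le_tsum z fun _ _ => hu0 _) (by linarith)) (hu0 z)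
      · exact zero_le
    have hfin := hle.trans (ENNReal.tsum_le_tsum hterm)
    rw [← ENNReal.ofReal_tsum_of_nonneg (fun z => by have := hu0 z; positivity)
      ((hus.mul_right _).mul_left _), tsum_mul_left, tsum_mul_right, ← hU, ← hsplit U hU0] at hfin
    exact (ENNReal.ofReal_le_ofReal_iff (by positivity)).1 hfin
  -- Dividing by `W + 1` keeps the values strictly below 1 and allows `W = 0`.
  refine ⟨fun b => G b / (W + 1), fun b => div_nonneg (hG0 b) (by linarith), fun b => ?_, ?_⟩
  · rw [div_lt_one (by linarith)]; linarith [hGW b]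
  intro t ht hts
  obtain ⟨C, hC, hCw⟩ := hwt t ht hts
  refine ⟨C * (W + 1) ^ t, by positivity, ?_⟩
  have hGg : ∀ b b', C * |G b - G b'| ^ t =
      C * (W + 1) ^ t * |G b / (W + 1) - G b' / (W + 1)| ^ t := fun b b' => by
    rw [mul_assoc, ← Real.mul_rpow (by linarith) (abs_nonneg _), ← sub_div, abs_div,
      abs_of_pos (by linarith : 0 < W + 1), mul_div_cancel₀ _ (by linarith : W + 1 ≠ 0)]
  intro b hb b' hb'
  rw [← hGg]
  rcases le_total b b' with h | h
  · rw [abs_sub_comm, abs_of_nonneg (sub_nonneg.2 h)]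
    exact key t ht C hC hCw b hb b' hb' h
  · rw [abs_of_nonneg (sub_nonneg.2 h), abs_sub_comm (G b)]
    exact key t ht C hC hCw b' hb' b hb h

end Gaps

/-! ### Nested separated centres in ℝⁿ. -/

section Grid

/-- The point of the grid `{0, …, N - 1}ⁿ` with number `i`. -/
noncomputable def gridPoint (n N i : ℕ) : EuclideanSpace ℝ (Fin n) :=
  WithLp.toLp 2 fun l =>
    if h : i < N ^ n then ((finFunctionFinEquiv.symm ⟨i, h⟩ l : Fin N) : ℝ) else 0

theorem norm_gridPoint_le (n N i : ℕ) : ‖gridPoint n N i‖ ≤ n * N := by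
  rw [EuclideanSpace.norm_eq]
  refine Real.sqrt_le_iff.2 ⟨by positivity, ?_⟩
  have h : ∀ l, ‖gridPoint n N i l‖ ^ 2 ≤ (N : ℝ) ^ 2 := by
    intro l
    have : ‖gridPoint n N i l‖ ≤ N := by
      simp only [gridPoint]
      split_ifs with h
      · rw [Real.norm_natCast]
        exact_mod_cast (finFunctionFinEquiv.symm ⟨i, h⟩ l).2.le
      · simp
    gcongr
  calc ∑ l, ‖gridPoint n N i l‖ ^ 2 ≤ ∑ _l : Fin n, (N : ℝ) ^ 2 := Finset.sum_le_sum fun l _ => h l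
    _ = n * (N : ℝ) ^ 2 := by simp
    _ ≤ (n : ℝ) ^ 2 * (N : ℝ) ^ 2 := by
      gcongr
      exact_mod_cast Nat.le_self_pow two_ne_zero n
    _ = _ := by ring

theorem one_le_norm_gridPoint_sub {n N i j : ℕ} (hi : i < N ^ n) (hj : j < N ^ n) (hij : i ≠ j) :
    1 ≤ ‖gridPoint n N i - gridPoint n N j‖ := by
  have hne : finFunctionFinEquiv.symm (⟨i, hi⟩ : Fin (N ^ n)) ≠
      finFunctionFinEquiv.symm ⟨j, hj⟩ := fun h => by
    simpa [hij] using finFunctionFinEquiv.symm.injective h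
  obtain ⟨l, hl⟩ := Function.ne_iff.1 hne
  refine le_trans ?_ (PiLp.norm_apply_le _ l)
  simp only [gridPoint, PiLp.sub_apply, dif_pos hi, dif_pos hj]
  have hl' : ((finFunctionFinEquiv.symm (⟨i, hi⟩ : Fin (N ^ n)) l : ℕ) : ℤ) ≠
      (finFunctionFinEquiv.symm (⟨j, hj⟩ : Fin (N ^ n)) l : ℕ) := fun h =>
    hl (Fin.ext (by exact_mod_cast h))
  rw [Real.norm_eq_abs]
  exact_mod_cast Int.one_le_abs (sub_ne_zero.2 hl')

/-- The size of the cells of level `k`. -/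
noncomputable def scale (n k : ℕ) : ℝ := (16 * n : ℝ)⁻¹ ^ k / k.factorial

theorem scale_zero (n : ℕ) : scale n 0 = 1 := by simp [scale]

theorem scale_succ (n k : ℕ) : scale n (k + 1) = scale n k / (16 * n * (k + 1)) := by
  simp only [scale, Nat.factorial_succ, pow_succ]
  push_cast
  rw [mul_comm ((k : ℝ) + 1), ← div_div, div_div, div_eq_mul_inv, div_eq_mul_inv, div_eq_mul_inv,
    mul_inv, mul_inv, mul_inv]
  ring

theorem scale_pos {n : ℕ} (hn : 1 ≤ n) (k : ℕ) : 0 < scale n k := by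
  have : (0 : ℝ) < n := by exact_mod_cast hn
  rw [scale]; positivity

theorem scale_succ_le {n : ℕ} (hn : 1 ≤ n) (k : ℕ) : scale n (k + 1) ≤ scale n k / 16 := by
  have h1 : (1 : ℝ) ≤ n := by exact_mod_cast hn
  have h2 : (0 : ℝ) ≤ k := k.cast_nonneg
  rw [scale_succ]
  refine div_le_div_of_nonneg_left (scale_pos hn k).le (by norm_num) ?_
  nlinarith

theorem scale_le_one {n : ℕ} (hn : 1 ≤ n) (k : ℕ) : scale n k ≤ 1 := by
  induction k with
  | zero => rw [scale_zero]
  | succ k ih => linarith [scale_succ_le hn k, scale_pos hn k]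

/-- The centre of the cell number `q` of level `k`. -/
noncomputable def centre (n : ℕ) (x₀ : EuclideanSpace ℝ (Fin n)) :
    ℕ → ℕ → EuclideanSpace ℝ (Fin n)
  | 0, _ => x₀
  | k + 1, q => centre n x₀ k (q / (k + 1) ^ n) +
      scale n (k + 1) • gridPoint n (k + 1) (q % (k + 1) ^ n)

variable {n : ℕ} {x₀ : EuclideanSpace ℝ (Fin n)}

/-- A grid point has norm at most n(k+1); the factor 16n(k+1) in `scale_succ` cancels this and
leaves 1/16. -/
theorem norm_centre_succ_sub_le (hn : 1 ≤ n) (k q : ℕ) :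
    ‖centre n x₀ (k + 1) q - centre n x₀ k (q / (k + 1) ^ n)‖ ≤ scale n k / 16 := by
  have h1 : (0 : ℝ) < n := by exact_mod_cast hn
  rw [centre, add_sub_cancel_left, norm_smul, Real.norm_of_nonneg (scale_pos hn _).le]
  calc _ ≤ scale n (k + 1) * (n * (k + 1 : ℕ)) :=
        mul_le_mul_of_nonneg_left (norm_gridPoint_le _ _ _) (scale_pos hn _).le
    _ = _ := by rw [scale_succ]; push_cast; field_simp

theorem norm_centre_sub_le (hn : 1 ≤ n) (k q : ℕ) :
    ‖centre n x₀ k q - x₀‖ ≤ (1 - scale n k) / 8 := by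
  induction k generalizing q with
  | zero => simp [centre, scale_zero]
  | succ k ih =>
    have h1 := norm_sub_le_norm_sub_add_norm_sub (centre n x₀ (k + 1) q)
      (centre n x₀ k (q / (k + 1) ^ n)) x₀
    have h2 := norm_centre_succ_sub_le (x₀ := x₀) hn k q
    have h3 := ih (q / (k + 1) ^ n)
    linarith [scale_succ_le hn k, scale_pos hn k]

/-- Siblings are separated by the grid. Otherwise the parents are `scale n k` apart and each child
moves by at most 1/16 of that, so 7/8 of it remains, more than enough for the next scale. -/
theorem scale_le_norm_centre_sub (hn : 1 ≤ n) (k : ℕ) {q q' : ℕ} (hq : q < k.factorial ^ n)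
    (hq' : q' < k.factorial ^ n) (hne : q ≠ q') :
    scale n k ≤ ‖centre n x₀ k q - centre n x₀ k q'‖ := by
  induction k generalizing q q' with
  | zero => simp at hq hq'; omega
  | succ k ih =>
    have hpos : 0 < (k + 1) ^ n := by positivity
    rw [Nat.factorial_succ, mul_pow] at hq hq'
    by_cases h : q / (k + 1) ^ n = q' / (k + 1) ^ n
    · have hmod : q % (k + 1) ^ n ≠ q' % (k + 1) ^ n := fun h' => hne (by
        rw [← Nat.div_add_mod q ((k + 1) ^ n), ← Nat.div_add_mod q' ((k + 1) ^ n), h, h'])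
      rw [centre, centre, h, add_sub_add_left_eq_sub, ← smul_sub, norm_smul,
        Real.norm_of_nonneg (scale_pos hn _).le]
      exact le_mul_of_one_le_right (scale_pos hn _).le
        (one_le_norm_gridPoint_sub (Nat.mod_lt _ hpos) (Nat.mod_lt _ hpos) hmod)
    · have h1 := ih (Nat.div_lt_of_lt_mul hq) (Nat.div_lt_of_lt_mul hq') h
      have h2 := norm_centre_succ_sub_le (x₀ := x₀) hn k q
      have h3 := norm_centre_succ_sub_le (x₀ := x₀) hn k q'
      have h4 := norm_sub_le_norm_sub_add_norm_sub (centre n x₀ k (q / (k + 1) ^ n))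
        (centre n x₀ (k + 1) q) (centre n x₀ k (q' / (k + 1) ^ n))
      have h5 := norm_sub_le_norm_sub_add_norm_sub (centre n x₀ (k + 1) q)
        (centre n x₀ (k + 1) q') (centre n x₀ k (q' / (k + 1) ^ n))
      rw [norm_sub_rev] at h2
      linarith [scale_succ_le hn k, scale_pos hn k]

/-- A nested sequence of cells shrinks to a point. -/
theorem exists_forall_norm_sub_centre_le (hn : 1 ≤ n) (x₀ : EuclideanSpace ℝ (Fin n)) {q : ℕ → ℕ}
    (hq : ∀ k, q k = q (k + 1) / (k + 1) ^ n) :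
    ∃ x, ∀ k, ‖x - centre n x₀ k (q k)‖ ≤ scale n k / 8 := by
  obtain ⟨x, hx⟩ := IsCompact.nonempty_iInter_of_sequence_nonempty_isCompact_isClosed
    (fun k => Metric.closedBall (centre n x₀ k (q k)) (scale n k / 8))
    (fun k => Metric.closedBall_subset_closedBall' (by
      have := norm_centre_succ_sub_le (x₀ := x₀) hn k (q (k + 1))
      rw [← hq] at this
      rw [dist_eq_norm]
      linarith [scale_succ_le hn k, scale_pos hn k]))
    (fun k => Metric.nonempty_closedBall.2 (by linarith [scale_pos hn k]))
    (isCompact_closedBall _ _) (fun k => Metric.isClosed_closedBall)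
  exact ⟨x, fun k => by simpa [dist_eq_norm] using Set.mem_iInter.1 hx k⟩

/-- Ratio test: consecutive quotients are at most a constant times (k+1)^(-(nt-p)), which tends to 0
however large the constant. The shift by one level is there because increments at level k+1 are
controlled only by cells of level k. -/
theorem summable_factorial_rpow_mul_scale (hn : 1 ≤ n) {t p : ℝ} (hp : 0 ≤ p) (hpt : p < n * t) :
    Summable fun k : ℕ => (1 / (k.factorial : ℝ) ^ n) ^ t * (scale n (k + 1))⁻¹ ^ p := by
  have hn0 : (0 : ℝ) < n := by exact_mod_cast hn
  set u : ℕ → ℝ := fun k => (1 / (k.factorial : ℝ) ^ n) ^ t * (scale n (k + 1))⁻¹ ^ p with hu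
  have hu0 : ∀ k, 0 ≤ u k := fun k => by have := (scale_pos hn (k + 1)).le; positivity
  have hstep : ∀ k, u (k + 1) ≤ (32 * n : ℝ) ^ p * ((k : ℝ) + 1) ^ (-(n * t - p)) * u k := by
    intro k
    have hk : (0 : ℝ) < (k : ℝ) + 1 := by positivity
    have h1 : (1 / ((k + 1).factorial : ℝ) ^ n) ^ t =
        (1 / (k.factorial : ℝ) ^ n) ^ t * ((k : ℝ) + 1) ^ (-(n * t)) := by
      rw [Nat.factorial_succ]
      push_cast
      rw [mul_pow, ← one_div_mul_one_div_rev, Real.mul_rpow (by positivity) (by positivity),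
        Real.rpow_neg hk.le, Real.rpow_mul hk.le, Real.rpow_natCast, one_div (((k : ℝ) + 1) ^ n),
        Real.inv_rpow (by positivity)]
    have h2 : (scale n (k + 1 + 1))⁻¹ ^ p ≤
        (scale n (k + 1))⁻¹ ^ p * ((32 * n : ℝ) ^ p * ((k : ℝ) + 1) ^ p) := by
      have hs := scale_pos hn (k + 1)
      rw [← Real.mul_rpow (by positivity) hk.le, ← Real.mul_rpow (by positivity) (by positivity)]
      refine Real.rpow_le_rpow (inv_pos.2 (scale_pos hn _)).le ?_ hp
      rw [scale_succ n (k + 1), inv_div, div_eq_inv_mul]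
      refine mul_le_mul_of_nonneg_left ?_ (inv_pos.2 hs).le
      push_cast
      have : (0 : ℝ) ≤ k := k.cast_nonneg
      nlinarith
    have h3 : ((k : ℝ) + 1) ^ (-(n * t - p)) = ((k : ℝ) + 1) ^ (-(n * t)) * ((k : ℝ) + 1) ^ p := by
      rw [← Real.rpow_add hk]; congr 1; ring
    simp only [hu]
    rw [h1, h3]
    refine (mul_le_mul_of_nonneg_left h2 (by positivity)).trans_eq (by ring)
  refine summable_of_ratio_norm_eventually_le (r := 1 / 2) (by norm_num) ?_
  have hlim : Filter.Tendsto (fun k : ℕ => (32 * n : ℝ) ^ p * ((k : ℝ) + 1) ^ (-(n * t - p)))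
      Filter.atTop (𝓝 0) := by
    have h1 : Filter.Tendsto (fun k : ℕ => (k : ℝ) + 1) Filter.atTop Filter.atTop :=
      Filter.tendsto_atTop_add_const_right _ _ tendsto_natCast_atTop_atTop
    have := ((tendsto_rpow_neg_atTop (sub_pos.2 hpt)).comp h1).const_mul ((32 * n : ℝ) ^ p)
    simpa using this
  filter_upwards [hlim.eventually_le_const (by norm_num : (0 : ℝ) < 1 / 2)] with k hk
  rw [Real.norm_of_nonneg (hu0 _), Real.norm_of_nonneg (hu0 _)]
  exact (hstep k).trans (mul_le_mul_of_nonneg_right hk (hu0 k))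

end Grid

/-! ### The function attached to one parametrized set. -/

section Construction

open scoped ContDiff

/-- The number of the cell of level `k` that contains the parameter `g b`. -/
noncomputable def cell (n : ℕ) (g : ℝ → ℝ) (k : ℕ) (b : ℝ) : ℕ :=
  ⌊g b * (k.factorial ^ n : ℕ)⌋₊

open Classical in
/-- A point of `B` with parameter in the cell number `q` of level `k`, if there is one. -/
noncomputable def rep (n : ℕ) (g : ℝ → ℝ) (B : Set ℝ) (k q : ℕ) : ℝ :=
  if h : ∃ b ∈ B, cell n g k b = q then h.choose else 0

open Classical in
/-- The increment of the chosen points from level `k - 1` to level `k`. -/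
noncomputable def coef (n : ℕ) (g : ℝ → ℝ) (B : Set ℝ) : ℕ → ℕ → ℝ
  | 0, q => rep n g B 0 q
  -- Empty cells get 0; the default value of `rep` would give an increment outside the Hölder bound.
  | k + 1, q => if ∃ b ∈ B, cell n g (k + 1) b = q then
      rep n g B (k + 1) q - rep n g B k (q / (k + 1) ^ n) else 0

variable {n : ℕ} {g : ℝ → ℝ} {B : Set ℝ}

theorem cell_succ_div (k : ℕ) (b : ℝ) : cell n g k b = cell n g (k + 1) b / (k + 1) ^ n := by
  rw [cell, cell, ← Nat.floor_div_natCast, Nat.factorial_succ, mul_pow]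
  congr 1
  push_cast
  field_simp

theorem cell_lt (hg0 : ∀ b, 0 ≤ g b) (hg1 : ∀ b, g b < 1) (k : ℕ) (b : ℝ) :
    cell n g k b < k.factorial ^ n := by
  have hpos : (0 : ℝ) < (k.factorial ^ n : ℕ) := by exact_mod_cast pow_pos k.factorial_pos n
  rw [cell, Nat.floor_lt (mul_nonneg (hg0 b) hpos.le)]
  nlinarith [hg1 b]

theorem abs_sub_le_of_cell_eq (hg0 : ∀ b, 0 ≤ g b) {k : ℕ} {b b' : ℝ}
    (h : cell n g k b = cell n g k b') : |g b - g b'| ≤ 1 / (k.factorial : ℝ) ^ n := by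
  have hpos : (0 : ℝ) < (k.factorial ^ n : ℕ) := by exact_mod_cast pow_pos k.factorial_pos n
  have h1 := Nat.floor_le (mul_nonneg (hg0 b) hpos.le)
  have h2 := Nat.lt_floor_add_one (g b * (k.factorial ^ n : ℕ))
  have h3 := Nat.floor_le (mul_nonneg (hg0 b') hpos.le)
  have h4 := Nat.lt_floor_add_one (g b' * (k.factorial ^ n : ℕ))
  rw [cell, cell] at h
  rw [h] at h1 h2
  rw [← Nat.cast_pow, le_div_iff₀ hpos, ← abs_of_pos hpos, ← abs_mul, sub_mul,
    abs_le]
  constructor <;> linarith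

theorem rep_cell_spec (k : ℕ) {b : ℝ} (hb : b ∈ B) :
    rep n g B k (cell n g k b) ∈ B ∧ cell n g k (rep n g B k (cell n g k b)) = cell n g k b := by
  have h : ∃ b' ∈ B, cell n g k b' = cell n g k b := ⟨b, hb, rfl⟩
  rw [rep, dif_pos h]
  exact h.choose_spec

/-- The increments telescope along the branch of `b`, since its cells are nested by `cell_succ_div`.
-/
theorem sum_coef_cell (m : ℕ) {b : ℝ} (hb : b ∈ B) :
    ∑ k ∈ Finset.range (m + 1), coef n g B k (cell n g k b) = rep n g B m (cell n g m b) := by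
  induction m with
  | zero => simp [coef]
  | succ m ih => rw [Finset.sum_range_succ, ih, coef, if_pos ⟨b, hb, rfl⟩, ← cell_succ_div]; ring

section Bounds

variable {t C : ℝ}

theorem abs_sub_le_of_cell_eq_of_holder (hg0 : ∀ b, 0 ≤ g b) (ht : 0 ≤ t) (hC : 0 ≤ C)
    (hBg : ∀ b ∈ B, ∀ b' ∈ B, |b - b'| ≤ C * |g b - g b'| ^ t) {k : ℕ} {b b' : ℝ} (hb : b ∈ B)
    (hb' : b' ∈ B) (h : cell n g k b = cell n g k b') :
    |b - b'| ≤ C * (1 / (k.factorial : ℝ) ^ n) ^ t :=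
  (hBg b hb b' hb').trans (mul_le_mul_of_nonneg_left
    (Real.rpow_le_rpow (abs_nonneg _) (abs_sub_le_of_cell_eq hg0 h) ht) hC)

theorem abs_coef_succ_le (hg0 : ∀ b, 0 ≤ g b) (ht : 0 ≤ t) (hC : 0 ≤ C)
    (hBg : ∀ b ∈ B, ∀ b' ∈ B, |b - b'| ≤ C * |g b - g b'| ^ t) (k q : ℕ) :
    |coef n g B (k + 1) q| ≤ C * (1 / (k.factorial : ℝ) ^ n) ^ t := by
  rw [coef]
  split_ifs with h
  · obtain ⟨b, hb, rfl⟩ := h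
    rw [← cell_succ_div]
    have h1 := rep_cell_spec (n := n) (g := g) (k + 1) hb
    have h0 := rep_cell_spec (n := n) (g := g) k hb
    refine abs_sub_le_of_cell_eq_of_holder hg0 ht hC hBg h1.1 h0.1 ?_
    rw [h0.2, cell_succ_div, h1.2, ← cell_succ_div]
  · rw [abs_zero]; positivity

/-- A majorant of the coefficients of level `k`. -/
noncomputable def coefBound (n : ℕ) (g : ℝ → ℝ) (B : Set ℝ) (t C : ℝ) : ℕ → ℝ
  | 0 => |rep n g B 0 0|
  | k + 1 => C * (1 / (k.factorial : ℝ) ^ n) ^ t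

theorem coefBound_nonneg (hC : 0 ≤ C) (k : ℕ) : 0 ≤ coefBound n g B t C k := by
  cases k with
  | zero => exact abs_nonneg _
  | succ k => rw [coefBound]; positivity

theorem abs_coef_le (hg0 : ∀ b, 0 ≤ g b) (ht : 0 ≤ t) (hC : 0 ≤ C)
    (hBg : ∀ b ∈ B, ∀ b' ∈ B, |b - b'| ≤ C * |g b - g b'| ^ t) (k q : ℕ)
    (hq : q < k.factorial ^ n) : |coef n g B k q| ≤ coefBound n g B t C k := by
  cases k with
  | zero =>
    have : q = 0 := by simpa using hq
    rw [this, coef, coefBound]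
  | succ k => exact abs_coef_succ_le hg0 ht hC hBg k q

theorem summable_coefBound (hn : 1 ≤ n) {p : ℝ} (hp : 0 ≤ p) (hpt : p < n * t) :
    Summable fun k => coefBound n g B t C k * (scale n k)⁻¹ ^ p := by
  rw [← summable_nat_add_iff 1]
  refine ((summable_factorial_rpow_mul_scale hn hp hpt).mul_left C).congr fun k => ?_
  rw [coefBound, mul_assoc]

end Bounds

/-- A set with a parametrization by a subset of `[0, 1)` that is Hölder continuous with all
exponents `t < s` consists of critical values of a function of class `C^{<sn}` with small
support. -/
theorem exists_function_of_parametrization {s : ℝ} (hs : 1 < s) (hn : 1 ≤ n)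
    (hg0 : ∀ b, 0 ≤ g b) (hg1 : ∀ b, g b < 1)
    (hBg : ∀ t, 1 ≤ t → t < s →
      ∃ C, 0 ≤ C ∧ ∀ b ∈ B, ∀ b' ∈ B, |b - b'| ≤ C * |g b - g b'| ^ t)
    (x₀ : EuclideanSpace ℝ (Fin n)) :
    ∃ F : EuclideanSpace ℝ (Fin n) → ℝ, IsCLt (s * n) F ∧ (∀ y, 1 / 2 ≤ ‖y - x₀‖ → F y = 0) ∧
      ∀ b ∈ B, ∃ x, ‖x - x₀‖ < 1 / 2 ∧ F x = b ∧ fderiv ℝ F x = 0 := by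
  have hn0 : (0 : ℝ) < n := by exact_mod_cast hn
  have hn1 : (1 : ℝ) ≤ n := by exact_mod_cast hn
  let φ : ContDiffBump (0 : EuclideanSpace ℝ (Fin n)) := ⟨1 / 8, 1 / 4, by norm_num, by norm_num⟩
  obtain ⟨ρ, hρφ⟩ : ∃ ρ : EuclideanSpace ℝ (Fin n) → ℝ, ρ = φ := ⟨_, rfl⟩
  have hρ : ContDiff ℝ ∞ ρ := hρφ ▸ φ.contDiff
  have hρI : ∀ y, ρ y ∈ Set.Icc (0 : ℝ) 1 := fun y => hρφ ▸ ⟨φ.nonneg, φ.le_one⟩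
  have hρ0 : ∀ y, 1 / 4 ≤ ‖y‖ → ρ y = 0 := fun y hy =>
    hρφ ▸ φ.zero_of_le_dist (by rwa [dist_zero_right])
  have hρ1 : ∀ y, ‖y‖ ≤ 1 / 8 → ρ y = 1 := fun y hy =>
    hρφ ▸ φ.one_of_mem_closedBall (by rwa [mem_closedBall_zero_iff])
  have hρc : HasCompactSupport ρ := hρφ ▸ φ.hasCompactSupport
  have hD : ∀ j : ℕ, ∃ D, ∀ y, ‖iteratedFDeriv ℝ j ρ y‖ ≤ D := fun j =>
    (hρc.iteratedFDeriv j).exists_bound_of_continuous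
      (hρ.continuous_iteratedFDeriv (by exact_mod_cast le_top))
  choose D hD using hD
  have hD0 : ∀ j, 0 ≤ D j := fun j => (norm_nonneg _).trans (hD j 0)
  obtain ⟨f, hf⟩ : ∃ f : ℕ → EuclideanSpace ℝ (Fin n) → ℝ, ∀ k, f k =
    bumpLayer ρ (scale n k) (Finset.range (k.factorial ^ n)) (centre n x₀ k) (coef n g B k) :=
      ⟨_, fun _ => rfl⟩
  have hfs : ∀ k, ContDiff ℝ ∞ (f k) := fun k => hf k ▸ contDiff_bumpLayer hρ
  have hsep : ∀ k, ∀ q ∈ Finset.range (k.factorial ^ n), ∀ q' ∈ Finset.range (k.factorial ^ n),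
      q ≠ q' → scale n k ≤ ‖centre n x₀ k q - centre n x₀ k q'‖ := fun k q hq q' hq' h =>
    scale_le_norm_centre_sub hn k (Finset.mem_range.1 hq) (Finset.mem_range.1 hq') h
  have hbound : ∀ t C, 1 ≤ t → 0 ≤ C → (∀ b ∈ B, ∀ b' ∈ B, |b - b'| ≤ C * |g b - g b'| ^ t) →
      ∀ j k x, ‖iteratedFDeriv ℝ j (f k) x‖ ≤
        D j * coefBound n g B t C k * (scale n k)⁻¹ ^ j := by
    intro t C ht hC hB j k x
    rw [hf]
    exact norm_iteratedFDeriv_bumpLayer_le hρ hρ0 (scale_pos hn k) (hsep k)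
      (coefBound_nonneg hC k) (fun q hq => abs_coef_le hg0 (by linarith) hC hB k q
        (Finset.mem_range.1 hq)) (hD j) x
  -- One exponent above 1 gives 1 < n t₀, enough to differentiate the series term by term.
  obtain ⟨t₀, ht₀, ht₀s⟩ := exists_between hs
  obtain ⟨C₀, hC₀, hB₀⟩ := hBg t₀ ht₀.le ht₀s
  have hsum1 : Summable fun k => D 1 * (coefBound n g B t₀ C₀ k * (scale n k)⁻¹ ^ (1 : ℝ)) :=
    (summable_coefBound hn zero_le_one (by nlinarith)).mul_left _
  have hsum0 : Summable fun k => coefBound n g B t₀ C₀ k := by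
    simpa using summable_coefBound (g := g) (B := B) (t := t₀) (C := C₀) hn le_rfl (by positivity)
  have hsum' : Summable fun k : ℕ => C₀ * (1 / (k.factorial : ℝ) ^ n) ^ t₀ := by
    have := (summable_nat_add_iff 1).2 hsum0
    exact this
  have hfd : ∀ k x, ‖fderiv ℝ (f k) x‖ ≤
      D 1 * (coefBound n g B t₀ C₀ k * (scale n k)⁻¹ ^ (1 : ℝ)) := fun k x => by
    rw [← norm_iteratedFDeriv_one, Real.rpow_one]
    simpa [mul_assoc] using hbound t₀ C₀ ht₀.le hC₀ hB₀ 1 k x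
  have hf0 : ∀ x, Summable fun k => f k x := fun x => by
    refine Summable.of_norm_bounded (hsum0.mul_left (D 0)) fun k => ?_
    have := hbound t₀ C₀ ht₀.le hC₀ hB₀ 0 k x
    simpa using this
  refine ⟨fun x => ∑' k, f k x, ?_, fun y hy => ?_, fun b hb => ?_⟩
  · intro j r hr0 hr1 hjr
    -- The functions `f k` do not depend on t, only their majorants do, so t may be chosen afresh
    -- for each class.
    have hlt : max 1 (((j : ℝ) + r) / n) < s :=
      max_lt hs (by rwa [div_lt_iff₀ hn0])
    obtain ⟨t, ht, hts⟩ := exists_between hlt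
    have ht1 : 1 ≤ t := (le_max_left _ _).trans ht.le
    have htj : (j : ℝ) + r < n * t := by
      have := (le_max_right _ _).trans_lt ht
      rwa [div_lt_iff₀ hn0, mul_comm] at this
    obtain ⟨C, hC, hB⟩ := hBg t ht1 hts
    exact isCHolder_tsum hfs (scale_pos hn) (scale_le_one hn) (coefBound_nonneg hC) hD0
      (hbound t C ht1 hC hB) j r hr0 hr1.le (summable_coefBound hn (by positivity) htj)
  · have : ∀ k, f k y = 0 := fun k => by
      rw [hf]
      refine bumpLayer_eq_zero hρ0 (scale_pos hn k) fun q _ => ?_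
      have h1 := norm_centre_sub_le (x₀ := x₀) hn k q
      have h2 := norm_sub_le_norm_sub_add_norm_sub y (centre n x₀ k q) x₀
      linarith [scale_pos hn k, scale_le_one hn k]
    simp [this]
  · obtain ⟨x, hx⟩ := exists_forall_norm_sub_centre_le hn x₀
      (q := fun k => cell n g k b) (fun k => cell_succ_div k b)
    have hmem : ∀ k, cell n g k b ∈ Finset.range (k.factorial ^ n) := fun k =>
      Finset.mem_range.2 (cell_lt hg0 hg1 k b)
    refine ⟨x, ?_, ?_, ?_⟩
    · have := hx 0
      rw [centre, scale_zero] at this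
      linarith
    -- The partial sums at `x` are representatives lying in the same cell as `b`, hence they
    -- converge to `b`.
    · have h1 := (hf0 x).hasSum.tendsto_sum_nat.comp (Filter.tendsto_add_atTop_nat 1)
      have h2 : ∀ m, ∑ k ∈ Finset.range (m + 1), f k x = rep n g B m (cell n g m b) := by
        intro m
        rw [← sum_coef_cell m hb]
        refine Finset.sum_congr rfl fun k _ => ?_
        rw [hf]
        exact bumpLayer_eq_of_near hρ0 hρ1 (scale_pos hn k) (hsep k) (hmem k) (hx k)
      refine tendsto_nhds_unique h1 ?_
      refine tendsto_iff_dist_tendsto_zero.2 (squeeze_zero (fun _ => dist_nonneg) (fun m => ?_)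
        hsum'.tendsto_atTop_zero)
      have h3 := rep_cell_spec (n := n) (g := g) m hb
      simp only [Function.comp_apply]
      rw [h2, Real.dist_eq]
      exact abs_sub_le_of_cell_eq_of_holder hg0 (by linarith) hC₀ hB₀ h3.1 hb h3.2
    · rw [fderiv_tsum_apply hsum1 (fun k => (hfs k).differentiable (by simp)) hfd (hf0 x)]
      have : ∀ k, fderiv ℝ (f k) x = 0 := fun k => by
        rw [hf]
        exact fderiv_bumpLayer_eq_zero hρ hρI hρ0 hρ1 (scale_pos hn k) (hsep k) (hmem k) (hx k)
      simp [this]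

end Construction

/-! ### Gluing functions with far apart supports. -/

section Gluing

variable {E F : Type*} [NormedAddCommGroup E] [NormedSpace ℝ E]
  [NormedAddCommGroup F] [NormedSpace ℝ F]

theorem IsCHolder.of_eventuallyEq {k : ℕ} {r : ℝ} {f : E → F}
    (h : ∀ x, ∃ f' : E → F, IsCHolder k r f' ∧ f =ᶠ[𝓝 x] f') : IsCHolder k r f := by
  constructor
  · rw [contDiff_iff_contDiffAt]
    intro x
    obtain ⟨f', hf', he⟩ := h x
    exact hf'.contDiff.contDiffAt.congr_of_eventuallyEq he
  · intro x
    obtain ⟨f', hf', he⟩ := h x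
    obtain ⟨U, hU, M, hM⟩ := hf'.holder x
    refine ⟨U ∩ {y | iteratedFDeriv ℝ k f y = iteratedFDeriv ℝ k f' y},
      Filter.inter_mem hU (he.iteratedFDeriv ℝ k), M, fun y hy z hz => ?_⟩
    rw [hy.2, hz.2]
    exact hM y hy.1 z hz.1

theorem IsCLt.of_eventuallyEq {q : ℝ} {f : E → F}
    (h : ∀ x, ∃ f' : E → F, IsCLt q f' ∧ f =ᶠ[𝓝 x] f') : IsCLt q f := fun k r hr0 hr1 hkr =>
  IsCHolder.of_eventuallyEq fun x => by
    obtain ⟨f', hf', he⟩ := h x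
    exact ⟨f', hf' k r hr0 hr1 hkr, he⟩

theorem isCLt_zero (q : ℝ) : IsCLt q (fun _ : E => (0 : F)) := fun k r _ _ _ =>
  ⟨contDiff_const, fun x => ⟨Set.univ, Filter.univ_mem, 0, fun y _ z _ => by
    have : iteratedFDeriv ℝ k (fun _ : E => (0 : F)) = 0 := iteratedFDeriv_fun_zero
    simp [this]⟩⟩

/-- Near the ball where `f i` lives, the sum of functions with far apart supports is `f i`. -/
theorem tsum_eventuallyEq {E F : Type*} [NormedAddCommGroup E] [NormedAddCommGroup F]
    {c : ℕ → E} {f : ℕ → E → F} (hc : ∀ i j, i ≠ j → 2 ≤ ‖c i - c j‖)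
    (hf : ∀ i y, 1 / 2 ≤ ‖y - c i‖ → f i y = 0) {i : ℕ} {x : E} (hx : ‖x - c i‖ < 1) :
    (fun y => ∑' j, f j y) =ᶠ[𝓝 x] f i := by
  filter_upwards [Metric.ball_mem_nhds x (by norm_num : (0 : ℝ) < 1 / 2)] with y hy
  refine tsum_eq_single i fun j hj => hf j y ?_
  rw [mem_ball_iff_norm] at hy
  have h1 := hc i j hj.symm
  have h2 := norm_sub_le_norm_sub_add_norm_sub (c i) x (c j)
  have h3 := norm_sub_le_norm_sub_add_norm_sub x y (c j)
  rw [norm_sub_rev] at hx hy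
  linarith

/-- The class is local, and near each point the sum is either a single `f i` or zero. -/
theorem isCLt_tsum {c : ℕ → E} {f : ℕ → E → F} (hc : ∀ i j, i ≠ j → 2 ≤ ‖c i - c j‖)
    (hf : ∀ i y, 1 / 2 ≤ ‖y - c i‖ → f i y = 0) {q : ℝ} (hq : ∀ i, IsCLt q (f i)) :
    IsCLt q fun y => ∑' j, f j y := by
  refine IsCLt.of_eventuallyEq fun x => ?_
  by_cases h : ∃ i, ‖x - c i‖ < 1
  · obtain ⟨i, hi⟩ := h
    exact ⟨f i, hq i, tsum_eventuallyEq hc hf hi⟩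
  · push Not at h
    refine ⟨_, isCLt_zero q, ?_⟩
    filter_upwards [Metric.ball_mem_nhds x (by norm_num : (0 : ℝ) < 1 / 2)] with y hy
    rw [mem_ball_iff_norm, norm_sub_rev] at hy
    have : ∀ i, f i y = 0 := fun i => hf i y (by
      have := norm_sub_le_norm_sub_add_norm_sub x y (c i)
      linarith [h i])
    simp [this]

end Gluing

end MorseSard

/-! ### The countable union, with centres 2 apart on a line. -/

theorem theorem3p1 (s : ℝ) (hs : 1 < s) (A : Set ℝ) (hA : MorseSard.IsSigmaZeroLtSet s A)
    (n : ℕ) (hn : 1 ≤ n) :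
    ∃ F : EuclideanSpace ℝ (Fin n) → ℝ,
      MorseSard.IsCLt (s * n) F ∧ A ⊆ MorseSard.criticalValues F := by
  obtain ⟨B, hB, rfl⟩ := hA
  let e : EuclideanSpace ℝ (Fin n) := EuclideanSpace.single ⟨0, hn⟩ 1
  have he : ‖e‖ = 1 := by simp [e]
  let c : ℕ → EuclideanSpace ℝ (Fin n) := fun i => (2 * i : ℝ) • e
  have hc : ∀ i j, i ≠ j → 2 ≤ ‖c i - c j‖ := by
    intro i j hij
    have h : (1 : ℝ) ≤ |(i : ℝ) - j| := by
      have : (i : ℤ) - j ≠ 0 := by omega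
      exact_mod_cast Int.one_le_abs this
    rw [← sub_smul, norm_smul, he, mul_one, ← mul_sub, Real.norm_eq_abs, abs_mul, abs_two]
    linarith
  have hex : ∀ i, ∃ F : EuclideanSpace ℝ (Fin n) → ℝ, MorseSard.IsCLt (s * n) F ∧
      (∀ y, 1 / 2 ≤ ‖y - c i‖ → F y = 0) ∧
      ∀ b ∈ B i, ∃ x, ‖x - c i‖ < 1 / 2 ∧ F x = b ∧ fderiv ℝ F x = 0 := fun i => by
    obtain ⟨g, hg0, hg1, hg⟩ := (hB i).exists_parametrization hs
    exact MorseSard.exists_function_of_parametrization hs hn hg0 hg1 hg (c i)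
  choose f hf hf0 hfB using hex
  have hF := MorseSard.isCLt_tsum hc hf0 hf
  refine ⟨_, hF, Set.iUnion_subset fun i b hb => ?_⟩
  obtain ⟨x, hx, hxb, hxd⟩ := hfB i b hb
  have heq := MorseSard.tsum_eventuallyEq hc hf0 (i := i) (x := x) (by linarith)
  have hn1 : (1 : ℝ) ≤ n := by exact_mod_cast hn
  refine ⟨x, ⟨?_, ?_⟩, heq.eq_of_nhds.trans hxb⟩
  -- As 1 < sn, the class contains C¹ regularity.
  · exact (hF 1 0 le_rfl one_pos (by push_cast; nlinarith)).contDiff.differentiable (by simp) x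
  · rw [heq.fderiv_eq, hxd]
    exact LinearMap.rank_zero
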